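/- Let $X$ be a real reflexive Banach space and let $Z$ be a real Hausdorff locally convex topological vector space. Let $C\subseteq Z$ be a convex pointed cone, that is, $tc\in C$ for all $c\in C$, $t\ge 0$; $C+C=C$; and $C\cap(-C)=\{0\}$ (its interior may be empty). Let $K\subseteq X$ be nonempty, convex and closed. Let $D\subseteq K$ be self-segment-dense in $K$ in the weak topology of $X$, that is, $D$ is weakly dense in $K$ and, for all $x,y\in D$, the set $[x,y]\cap D$ is weakly dense in the segment $[x,y]$. A map $g:K\to Z$ is called strongly $C$-upper semicontinuous at $x\in K$ in the weak topology if for every $k\in C\setminus\{0\}$ there is a weak neighbourhood $U$ of $x$ such that $g(u)\in g(x)+k-(C\setminus\{0\})$ for all $u\in U\cap K$; it is called $C$-convex on $K$ if $$\sum_{i=1}^n\lambda_i g(x_i)-g\Big(\sum_{i=1}^n\lambda_i x_i\Big)\in C$$ for all $n\in\mathbb N$, $x_1,\dots,x_n\in K$ and $\lambda_1,\dots,\lambda_n\ge 0$ with $\sum_{i=1}^n\lambda_i=1$ and $\sum_{i=1}^n\lambda_i x_i\in K$. Let $f:K\times K\to Z$ satisfy: (i) for every $y\in D$, the map $x\mapsto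 f(x,y)$ is strongly $C$-upper semicontinuous, in the weak topology of $X$, at every point of $K$; (ii) for every $x\in K$, the map $y\mapsto f(x,y)$ (on $K$) is strongly $C$-upper semicontinuous, in the weak topology of $X$, at every point of $K\setminus D$; (iii) for every $x\in K$, the map $y\mapsto f(x,y)$ is $C$-convex on $K$; (iv) $f(x,x)=0$ for every $x\in K$; (v) there is $r>0$ such that for every $x\in K$ with $\|x\|>r$ there exists $y_0\in K$ with $\|y_0\|<\|x\|$ and $f(x,y_0)\in -C$. Then there exists $x_0\in K$ such that $f(x_0,y)\notin -C\setminus\{0\}$ for all $y\in K$. -/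

import Mathlib

open Set Topology
open scoped Pointwise

/-- A convex, pointed cone: `t • c ∈ C` for `c ∈ C` and `t ≥ 0`, `C + C = C`, `C ∩ (-C) = {0}`.
The last condition makes `C` nonempty. -/
structure IsConvexPointedCone {Z : Type*} [AddCommGroup Z] [Module ℝ Z] (C : Set Z) : Prop where
  smul_mem : ∀ c ∈ C, ∀ t : ℝ, 0 ≤ t → t • c ∈ C
  add_eq : C + C = C
  inter_neg_eq : C ∩ (-C) = {0}

/-- `g`, regarded as a map on `K`, is strongly `C`-upper semicontinuous at `x`: for every
`k ∈ C \ {0}` there is a neighbourhood `U` of `x` with `g u ∈ g x + k - C \ {0}` for all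
`u ∈ U ∩ K`. -/
def StronglyCUpperSemicontinuousAt {E Z : Type*} [TopologicalSpace E] [AddCommGroup Z]
    (C : Set Z) (K : Set E) (g : E → Z) (x : E) : Prop :=
  ∀ k ∈ C \ {0}, ∃ U ∈ 𝓝 x, ∀ u ∈ U ∩ K, g u ∈ ({g x + k} : Set Z) - (C \ {0})

/-- `g` is `C`-convex on the (not necessarily convex) set `K`, for the order
`z₁ ≤ z₂ ↔ z₂ - z₁ ∈ C`. -/
def CConvexOn {E Z : Type*} [AddCommGroup E] [Module ℝ E] [AddCommGroup Z] [Module ℝ Z]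
    (C : Set Z) (K : Set E) (g : E → Z) : Prop :=
  ∀ (n : ℕ) (x : Fin n → E) (l : Fin n → ℝ), (∀ i, x i ∈ K) → (∀ i, 0 ≤ l i) →
    ∑ i, l i = 1 → ∑ i, l i • x i ∈ K →
    (∑ i, l i • g (x i)) - g (∑ i, l i • x i) ∈ C

/-- `U` is self-segment-dense in the (convex) set `V`, for the topology of `E`. -/
structure IsSelfSegmentDense {E : Type*} [AddCommGroup E] [Module ℝ E] [TopologicalSpace E]
    (U V : Set E) : Prop where
  subset : U ⊆ V
  dense : V ⊆ closure U
  segment_dense : ∀ x ∈ U, ∀ y ∈ U, segment ℝ x y ⊆ closure (segment ℝ x y ∩ U)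

/-- A real normed space is reflexive if the canonical embedding into its bidual is onto. -/
def IsReflexiveSpace (X : Type*) [NormedAddCommGroup X] [NormedSpace ℝ X] : Prop :=
  Function.Surjective (NormedSpace.inclusionInDoubleDual ℝ X)

/-- Self-segment-density in the weak topology of `X`. -/
def IsWeaklySelfSegmentDense {X : Type*} [NormedAddCommGroup X] [NormedSpace ℝ X]
    (U V : Set X) : Prop :=
  IsSelfSegmentDense (toWeakSpace ℝ X '' U) (toWeakSpace ℝ X '' V)

/-- Strong `C`-upper semicontinuity at `x` of the map `g` on `K`, in the weak topology of `X`. -/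
def WeaklyStronglyCUpperSemicontinuousAt {X Z : Type*} [NormedAddCommGroup X] [NormedSpace ℝ X]
    [AddCommGroup Z] (C : Set Z) (K : Set X) (g : X → Z) (x : X) : Prop :=
  StronglyCUpperSemicontinuousAt C (toWeakSpace ℝ X '' K)
    (fun w : WeakSpace ℝ X => g ((toWeakSpace ℝ X).symm w)) (toWeakSpace ℝ X x)

/-! Call a value negative if it lies in `(-C) \ {0}`. Fix `R > r` with `K` meeting the open
`R`-ball; by reflexivity `S = K ∩ closedBall 0 R` is weakly compact. For `y ∈ D` with `‖y‖ < R`, let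
`U y` be the weak interior of the set of `x` with `f x y` negative. If a convex combination `x` of
such points lay in `U y` for each `y` of positive weight, `C`-convexity would make `f x x = 0`
negative. Fan's principle therefore gives `x₀ ∈ S` outside every `U y`, and semicontinuity in the
first variable shows that `f x₀` is negative at no point of `D` in the open ball.

Suppose `f x₀ y` is negative for some `y ∈ K`. Coercivity gives `b ∈ K` with `‖b‖ < R` and `f x₀ b ∈
-C`; a point `p` of the segment from `b` to `y`, close to `b`, stays in the open ball and has `f x₀
p` negative. Semicontinuity in the second variable and norm density of `D` in `K` move `p` into `D`,
a contradiction.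

Fan's principle comes from the KKM lemma, hence from Brouwer's theorem for `C¹` maps, which is
proved by the Milnor–Rogers volume argument. -/

section Brouwer

/-! ### Brouwer's theorem for `C¹` maps. -/

open MeasureTheory Metric

/-- A perturbation of the identity by a contraction is a bijection. -/
lemma LipschitzWith.bijective_id_add {E : Type*} [NormedAddCommGroup E] [CompleteSpace E]
    {w : E → E} {c : NNReal} (hw : LipschitzWith c w) (hc : c < 1) :
    Function.Bijective fun x => x + w x := by
  constructor
  · intro x y hxy
    by_contra hne
    have h1 : x - y = w y - w x := by
      have : x + w x = y + w y := hxy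
      rw [sub_eq_sub_iff_add_eq_add, this, add_comm]
    have h2 : ‖w y - w x‖ ≤ c * ‖y - x‖ := hw.norm_sub_le y x
    rw [← h1, norm_sub_rev] at h2
    have h3 : 0 < ‖y - x‖ := norm_pos_iff.2 (sub_ne_zero.2 (Ne.symm hne))
    have h4 : (c : ℝ) < 1 := by exact_mod_cast hc
    nlinarith
  · intro y
    have hcon : ContractingWith c fun x => y - w x := by
      refine ⟨hc, LipschitzWith.of_dist_le_mul fun a b => ?_⟩
      rw [dist_sub_left]
      exact hw.dist_le_mul a b
    refine ⟨hcon.fixedPoint, ?_⟩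
    have := hcon.fixedPoint_isFixedPt
    have h : y - w hcon.fixedPoint = hcon.fixedPoint := this
    exact (sub_eq_iff_eq_add.1 h).symm

section Det

variable {E : Type*} [NormedAddCommGroup E] [NormedSpace ℝ E]

lemma continuous_det_one_add_smul (A : E →L[ℝ] E) :
    Continuous fun t : ℝ => (1 + t • A).det :=
  ContinuousLinearMap.continuous_det.comp (by fun_prop)

/-- `det (1 + t A)` is a polynomial in `t` of degree at most the dimension. -/
lemma exists_polynomial_det_one_add_smul [FiniteDimensional ℝ E] (A : E →L[ℝ] E) :
    ∃ p : Polynomial ℝ, p.natDegree ≤ Module.finrank ℝ E ∧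
      ∀ t : ℝ, p.eval t = (1 + t • A).det := by
  classical
  let b := Module.finBasis ℝ E
  let M := LinearMap.toMatrix b b (A : E →ₗ[ℝ] E)
  let A₀ : Matrix (Fin (Module.finrank ℝ E)) (Fin (Module.finrank ℝ E)) ℝ := 1
  refine ⟨((Polynomial.X : Polynomial ℝ) • M.map ⇑Polynomial.C + A₀.map ⇑Polynomial.C).det, ?_, fun t => ?_⟩
  · simpa using Polynomial.natDegree_det_X_add_C_le M A₀
  · rw [← Polynomial.coe_evalRingHom, RingHom.map_det, ContinuousLinearMap.det,
      ← LinearMap.det_toMatrix b]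
    congr 1
    have : ((1 + t • A : E →L[ℝ] E) : E →ₗ[ℝ] E) = LinearMap.id + t • (A : E →ₗ[ℝ] E) := rfl
    have hm : LinearMap.toMatrix b b (LinearMap.id + t • (A : E →ₗ[ℝ] E)) = A₀ + t • M := by
      rw [map_add, map_smul, LinearMap.toMatrix_id]
    rw [this, hm]
    ext i j
    by_cases hij : i = j
    · subst hij; simp [M, A₀, add_comm, mul_comm t]
    · simp [M, A₀, hij, mul_comm t]

/-- Along `1 + t • A`, `t ∈ [0, 1]`, the determinant starts at `1` and never vanishes, since a
kernel vector would satisfy `‖x‖ ≤ ‖A x‖ < ‖x‖`. -/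
lemma det_one_add_pos [FiniteDimensional ℝ E] {A : E →L[ℝ] E} (hA : ‖A‖ < 1) :
    0 < (1 + A).det := by
  have hne : ∀ t ∈ Icc (0 : ℝ) 1, (1 + t • A).det ≠ 0 := by
    intro t ht h0
    obtain ⟨x, hx, hx0⟩ := (Submodule.ne_bot_iff _).1 (LinearMap.det_eq_zero_iff_ker_ne_bot.1 h0)
    have h1 : x + t • A x = 0 := hx
    have h2 : ‖x‖ = ‖t • A x‖ := by
      rw [← norm_neg (t • A x), ← eq_neg_of_add_eq_zero_left h1]
    have h3 : ‖t • A x‖ ≤ ‖A x‖ := by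
      rw [norm_smul, Real.norm_of_nonneg ht.1]
      exact mul_le_of_le_one_left (norm_nonneg _) ht.2
    have h4 := A.le_opNorm x
    have h5 : 0 < ‖x‖ := norm_pos_iff.2 hx0
    nlinarith
  by_contra! hneg
  have h0 : (1 + (0 : ℝ) • A).det = 1 := by
    rw [zero_smul, add_zero]; exact LinearMap.det_id
  have h1 : (1 + (1 : ℝ) • A).det ≤ 0 := by rwa [one_smul]
  obtain ⟨t, ht, h⟩ := intermediate_value_Icc' (zero_le_one' ℝ)
    (continuous_det_one_add_smul A).continuousOn
    (show (0 : ℝ) ∈ Icc _ _ from ⟨h1, by rw [h0]; exact zero_le_one⟩)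
  exact hne t ht h

end Det

section Extension

variable {E : Type*} [NormedAddCommGroup E] [NormedSpace ℝ E]

/-- A map vanishing on a sphere and Lipschitz on the closed ball stays Lipschitz when extended
by zero. -/
lemma LipschitzOnWith.indicator_closedBall {F : Type*} [NormedAddCommGroup F] {u : E → F}
    {R : ℝ} {L : NNReal}
    (hu : LipschitzOnWith L u (closedBall 0 R)) (h0 : ∀ x, ‖x‖ = R → u x = 0) :
    LipschitzWith L ((closedBall (0 : E) R).indicator u) := by
  have key : ∀ x ∈ closedBall (0 : E) R, ∀ y ∉ closedBall (0 : E) R,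
      ‖u x‖ ≤ L * ‖x - y‖ := by
    intro x hx y hy
    have hx' : ‖x‖ ≤ R := by simpa using hx
    have hy' : R ≤ ‖y‖ := by simpa using (not_le.1 (by simpa using hy)).le
    -- The segment from `x` to `y` crosses the sphere, where `u` vanishes.
    obtain ⟨t, ht, hR⟩ := intermediate_value_Icc (zero_le_one' ℝ)
      (f := fun t : ℝ => ‖x + t • (y - x)‖) (by fun_prop)
      (show R ∈ Icc _ _ by simpa using ⟨hx', hy'⟩)
    have hz := h0 _ hR
    have h1 := hu.norm_sub_le hx (show x + t • (y - x) ∈ closedBall (0 : E) R by simpa using hR.le)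
    rw [hz, sub_zero] at h1
    refine h1.trans (mul_le_mul_of_nonneg_left ?_ L.2)
    rw [sub_add_cancel_left, norm_neg, norm_smul, Real.norm_of_nonneg ht.1, norm_sub_rev]
    exact mul_le_of_le_one_left (norm_nonneg _) ht.2
  refine LipschitzWith.of_dist_le_mul fun x y => ?_
  rw [dist_eq_norm, dist_eq_norm]
  by_cases hx : x ∈ closedBall (0 : E) R <;> by_cases hy : y ∈ closedBall (0 : E) R
  · simpa only [indicator_of_mem hx, indicator_of_mem hy] using hu.norm_sub_le hx hy
  · simpa only [indicator_of_mem hx, indicator_of_notMem hy, sub_zero] using key x hx y hy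
  · simpa only [indicator_of_notMem hx, indicator_of_mem hy, zero_sub, norm_neg, norm_sub_rev]
      using key y hy x hx
  · simp only [indicator_of_notMem hx, indicator_of_notMem hy, sub_zero, norm_zero]
    positivity

end Extension

section Milnor

variable {E : Type*} [NormedAddCommGroup E] [NormedSpace ℝ E] [FiniteDimensional ℝ E]
  [MeasurableSpace E] [BorelSpace E] (μ : Measure E) [μ.IsAddHaarMeasure]

/-- For small `t`, `x ↦ x + t • u x`, extended by the identity, is a bijection of the space fixing
the complement of the ball. It therefore maps the ball onto itself, with positive Jacobian, and the
integral is a change of variables. -/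
lemma integral_det_one_add_smul_eq_of_small {u : E → E} {R : ℝ} {L : NNReal}
    (hd : ∀ x ∈ ball (0 : E) R, DifferentiableAt ℝ u x)
    (hL : LipschitzOnWith L u (closedBall 0 R)) (h0 : ∀ x, ‖x‖ = R → u x = 0)
    {t : ℝ} (ht : 0 ≤ t) (htL : t * L < 1) :
    ∫ x in ball (0 : E) R, (1 + t • fderiv ℝ u x).det ∂μ = μ.real (ball 0 R) := by
  set w := (closedBall (0 : E) R).indicator u with hwdef
  have hw : LipschitzWith L w := hL.indicator_closedBall h0
  lift t to NNReal using ht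
  have htw : LipschitzWith (t * L) fun x => (t : ℝ) • w x :=
    LipschitzWith.of_dist_le_mul fun x y => by
      rw [dist_smul₀, NNReal.coe_mul, mul_assoc, Real.norm_of_nonneg t.coe_nonneg]
      exact mul_le_mul_of_nonneg_left (hw.dist_le_mul x y) t.2
  have hlt : t * L < 1 := by exact_mod_cast htL
  have hbij := htw.bijective_id_add hlt
  have hout : ∀ x ∉ ball (0 : E) R, w x = 0 := by
    intro x hx
    by_cases hx' : x ∈ closedBall (0 : E) R
    · rw [hwdef, indicator_of_mem hx']
      exact h0 x (le_antisymm (by simpa using hx') (by simpa using hx))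
    · rw [hwdef, indicator_of_notMem hx']
  have himage : (fun x => x + (t : ℝ) • w x) '' ball (0 : E) R = ball 0 R := by
    have hc : (fun x => x + (t : ℝ) • w x) '' (ball (0 : E) R)ᶜ = (ball 0 R)ᶜ := by
      rw [image_congr (g := id), image_id]
      intro x hx
      simp [hout x hx]
    have := image_compl_eq (s := ball (0 : E) R) hbij
    rw [hc] at this
    exact (compl_injective this).symm
  have heq : EqOn w u (ball (0 : E) R) := fun x hx =>
    indicator_of_mem (ball_subset_closedBall hx) u
  have hder : ∀ x ∈ ball (0 : E) R, HasFDerivWithinAt (fun x => x + (t : ℝ) • w x)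
      (1 + (t : ℝ) • fderiv ℝ u x) (ball 0 R) x := by
    intro x hx
    have h1 : HasFDerivAt (fun x => x + (t : ℝ) • u x) (1 + (t : ℝ) • fderiv ℝ u x) x :=
      (hasFDerivAt_id x).add ((hd x hx).hasFDerivAt.const_smul (t : ℝ))
    refine h1.hasFDerivWithinAt.congr (fun y hy => ?_) ?_
    · simp only [heq hy]
    · simp only [heq hx]
  have hcv := integral_image_eq_integral_abs_det_fderiv_smul μ measurableSet_ball hder
    hbij.1.injOn (fun _ => (1 : ℝ))
  rw [himage] at hcv
  simp only [integral_const, smul_eq_mul, mul_one, measureReal_restrict_apply_univ] at hcv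
  rw [hcv]
  refine setIntegral_congr_fun measurableSet_ball fun x hx => ?_
  refine (abs_of_pos (det_one_add_pos ?_)).symm
  have h2 : ‖fderiv ℝ u x‖ ≤ L :=
    norm_fderiv_le_of_lipschitzOn ℝ (isOpen_ball.mem_nhds hx) (hL.mono ball_subset_closedBall)
  rw [norm_smul, Real.norm_of_nonneg t.coe_nonneg]
  exact (mul_le_mul_of_nonneg_left h2 t.2).trans_lt htL

/-- The integrand for parameter `t` is polynomial in `t`, so its value at `t = 1` is a fixed linear
combination of its values at `finrank + 1` small parameters, where the integral is known. -/
lemma integral_det_one_add_eq {u : E → E} {R : ℝ} {U : Set E} (hU : IsOpen U)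
    (hRU : closedBall 0 R ⊆ U) (hu : ContDiffOn ℝ 1 u U) (h0 : ∀ x, ‖x‖ = R → u x = 0) :
    ∫ x in ball (0 : E) R, (1 + fderiv ℝ u x).det ∂μ = μ.real (ball 0 R) := by
  classical
  have hd : ∀ x ∈ ball (0 : E) R, DifferentiableAt ℝ u x := fun x hx =>
    (hu.differentiableOn one_ne_zero).differentiableAt
      (hU.mem_nhds (hRU (ball_subset_closedBall hx)))
  obtain ⟨L, hL⟩ := ((hu.mono hRU).locallyLipschitzOn
    (convex_closedBall _ _)).exists_lipschitzOnWith_of_compact (isCompact_closedBall _ _)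
  have hint : ∀ t : ℝ, IntegrableOn (fun x => (1 + t • fderiv ℝ u x).det) (ball 0 R) μ := by
    intro t
    have hc : ContinuousOn (fun x => (1 + t • fderiv ℝ u x).det) (closedBall 0 R) :=
      ContinuousLinearMap.continuous_det.comp_continuousOn
        (continuousOn_const.add
          (((hu.continuousOn_fderiv_of_isOpen hU le_rfl).mono hRU).const_smul t))
    exact (hc.integrableOn_compact (isCompact_closedBall _ _)).mono_set ball_subset_closedBall
  set s := Finset.range (Module.finrank ℝ E + 1) with hs
  -- Chosen so that every node `k / N` with `k ≤ finrank` satisfies `k / N * L < 1`; `L + 1` keeps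
  -- `N` positive when `L = 0`.
  set N : ℝ := (Module.finrank ℝ E + 1) * (L + 1) with hN
  have hNpos : 0 < N := by positivity
  set v : ℕ → ℝ := fun k => k / N with hv
  have hvinj : Set.InjOn v s := by
    intro a _ b _ hab
    have : (a : ℝ) = b := (div_left_inj' hNpos.ne').1 hab
    exact_mod_cast this
  have hvs : ∀ k ∈ s, 0 ≤ v k ∧ v k * L < 1 := by
    intro k hk
    refine ⟨by positivity, ?_⟩
    have hk' : (k : ℝ) < Module.finrank ℝ E + 1 := by
      exact_mod_cast Finset.mem_range.1 hk
    rw [hv, div_mul_eq_mul_div, div_lt_one hNpos, hN]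
    have : (0 : ℝ) ≤ L := L.2
    have : (0 : ℝ) ≤ k := k.cast_nonneg
    nlinarith
  have hpoly : ∀ x, (1 + fderiv ℝ u x).det =
      ∑ k ∈ s, (1 + v k • fderiv ℝ u x).det * (Lagrange.basis s v k).eval 1 := by
    intro x
    obtain ⟨p, hp, hpe⟩ := exists_polynomial_det_one_add_smul (fderiv ℝ u x)
    have hdeg : p.degree < s.card := by
      rw [hs, Finset.card_range]
      exact (Polynomial.degree_le_of_natDegree_le hp).trans_lt (by exact_mod_cast Nat.lt_succ_self _)
    have h1 := hpe 1
    rw [one_smul] at h1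
    rw [← h1, Lagrange.eq_interpolate hvinj hdeg, Lagrange.interpolate_apply,
      Polynomial.eval_finsetSum]
    simp only [Polynomial.eval_mul, Polynomial.eval_C]
    refine Finset.sum_congr rfl fun k hk => ?_
    rw [← hpe]
  have hone : ∑ k ∈ s, (Lagrange.basis s v k).eval 1 = 1 := by
    rw [← Polynomial.eval_finsetSum, Lagrange.sum_basis hvinj ⟨0, by simp [hs]⟩,
      Polynomial.eval_one]
  simp only [hpoly]
  rw [integral_finsetSum _ fun k _ => (hint (v k)).mul_const _]
  simp only [integral_mul_const]
  rw [Finset.sum_congr rfl fun k hk => by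
    rw [integral_det_one_add_smul_eq_of_small μ hd hL h0 (hvs k hk).1 (hvs k hk).2],
    ← Finset.mul_sum, hone, mul_one]

end Milnor

/-- There is no `C¹` retraction of a closed ball onto its boundary sphere. -/
theorem not_exists_contDiffOn_retraction {E : Type*} [NormedAddCommGroup E]
    [InnerProductSpace ℝ E] [FiniteDimensional ℝ E] {R : ℝ} (hR : 0 < R) {U : Set E}
    (hU : IsOpen U) (hRU : closedBall 0 R ⊆ U) {u : E → E} (hu : ContDiffOn ℝ 1 u U)
    (h0 : ∀ x, ‖x‖ = R → u x = 0) (h1 : ∀ x ∈ ball (0 : E) R, ‖x + u x‖ = R) : False := by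
  let _ : MeasurableSpace E := borel E
  have : BorelSpace E := ⟨rfl⟩
  let μ : Measure E := Measure.addHaar
  have key := integral_det_one_add_eq μ hU hRU hu h0
  have hdet : ∀ x ∈ ball (0 : E) R, (1 + fderiv ℝ u x).det = 0 := by
    intro x hx
    have hdu : DifferentiableAt ℝ u x := (hu.differentiableOn one_ne_zero).differentiableAt
      (hU.mem_nhds (hRU (ball_subset_closedBall hx)))
    have hd : HasFDerivAt (fun x => x + u x) (1 + fderiv ℝ u x) x :=
      (hasFDerivAt_id x).add hdu.hasFDerivAt
    -- Constant norm makes `x + u x` orthogonal to the range of the derivative; were that derivative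
    -- onto, `x + u x` would be orthogonal to itself.
    have hconst : (fun y => ‖y + u y‖ ^ 2) =ᶠ[𝓝 x] fun _ => R ^ 2 := by
      filter_upwards [isOpen_ball.mem_nhds hx] with y hy
      rw [h1 y hy]
    have hz := hd.norm_sq.unique ((hasFDerivAt_const (R ^ 2) x).congr_of_eventuallyEq hconst)
    by_contra hne
    have hsurj : Function.Surjective ((1 + fderiv ℝ u x : E →L[ℝ] E) : E →ₗ[ℝ] E) := by
      rw [← LinearMap.injective_iff_surjective, ← LinearMap.ker_eq_bot]
      by_contra hr
      exact hne (LinearMap.det_eq_zero_iff_ker_ne_bot.2 hr)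
    obtain ⟨y, hy⟩ := hsurj (x + u x)
    have hy' : (1 + fderiv ℝ u x : E →L[ℝ] E) y = x + u x := hy
    have hzy := congrArg (fun T : E →L[ℝ] ℝ => T y) hz
    simp only [smul_apply, ContinuousLinearMap.comp_apply, hy',
      innerSL_apply_apply, real_inner_self_eq_norm_sq, h1 x hx,
      zero_apply] at hzy
    simp at hzy
    exact hR.ne' hzy
  rw [setIntegral_congr_fun measurableSet_ball hdet, integral_zero] at key
  exact (ENNReal.toReal_pos (measure_ball_pos μ (0 : E) hR).ne' measure_ball_lt_top.ne).ne key

/-- Brouwer's fixed point theorem for `C¹` maps into the unit ball. -/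
theorem exists_fixedPoint_of_contDiff_of_norm_le_one {E : Type*} [NormedAddCommGroup E]
    [InnerProductSpace ℝ E] [FiniteDimensional ℝ E] {g : E → E} (hg : ContDiff ℝ 1 g)
    (hb : ∀ x, ‖g x‖ ≤ 1) : ∃ x, g x = x := by
  by_contra! hne
  set v : E → E := fun x => x - g x with hv
  have hvne : ∀ x, v x ≠ 0 := fun x => sub_ne_zero.2 (hne x).symm
  have hvc : ContDiff ℝ 1 v := contDiff_id.sub hg
  -- `x + s • v x` has norm `2` exactly when `a s² + 2 b s + c = 0`; the larger root, taken below,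
  -- gives the retraction. Radius `2` exceeds the bound on `g`, so `b > 0` on the sphere and the
  -- root there is `0`.
  set a : E → ℝ := fun x => ‖v x‖ ^ 2 with ha
  set b : E → ℝ := fun x => inner ℝ x (v x) with hbdef
  set c : E → ℝ := fun x => ‖x‖ ^ 2 - 4 with hc
  have hapos : ∀ x, 0 < a x := fun x => by
    have := norm_pos_iff.2 (hvne x); positivity
  have hac : ContDiff ℝ 1 a := hvc.norm_sq ℝ
  have hbc : ContDiff ℝ 1 b := contDiff_id.inner ℝ hvc
  have hcc : ContDiff ℝ 1 c := (contDiff_id.norm_sq ℝ).sub contDiff_const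
  set d : E → ℝ := fun x => b x ^ 2 - a x * c x with hd
  have hdc : ContDiff ℝ 1 d := (hbc.pow 2).sub (hac.mul hcc)
  have hbpos : ∀ x, ‖x‖ = 2 → 0 < b x := by
    intro x hx
    have h1 : inner ℝ x (g x) ≤ ‖x‖ * ‖g x‖ := real_inner_le_norm _ _
    have h2 : b x = ‖x‖ ^ 2 - inner ℝ x (g x) := by
      rw [hbdef, hv]; simp only [inner_sub_right, real_inner_self_eq_norm_sq]
    have := hb x
    rw [hx] at h1 h2
    nlinarith
  have hdpos : ∀ x ∈ closedBall (0 : E) 2, 0 < d x := by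
    intro x hx
    have hx' : ‖x‖ ≤ 2 := by simpa using hx
    rcases hx'.lt_or_eq with h | h
    · have hcneg : c x < 0 := by
        have := norm_nonneg x
        simp only [hc]; nlinarith
      have := mul_pos_of_neg_of_neg (neg_lt_zero.2 (hapos x)) hcneg
      simp only [hd]; nlinarith [sq_nonneg (b x)]
    · have := hbpos x h
      have hc0 : c x = 0 := by simp only [hc, h]; norm_num
      simp only [hd, hc0]; nlinarith
  set s : E → ℝ := fun x => (Real.sqrt (d x) - b x) / a x with hs
  have hsc : ContDiffOn ℝ 1 s {x | 0 < d x} := fun x hx =>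
    (((hdc.contDiffAt.sqrt (ne_of_gt hx)).sub hbc.contDiffAt).div hac.contDiffAt
      (hapos x).ne').contDiffWithinAt
  refine not_exists_contDiffOn_retraction (u := fun x => s x • v x) two_pos
    (isOpen_lt continuous_const hdc.continuous) hdpos (hsc.smul hvc.contDiffOn) ?_ ?_
  · intro x hx
    have hc0 : c x = 0 := by simp only [hc, hx]; norm_num
    have : s x = 0 := by
      simp only [hs, hd, hc0, mul_zero, sub_zero, Real.sqrt_sq (hbpos x hx).le, sub_self, zero_div]
    simp only [this, zero_smul]
  · intro x hx
    have hsq := Real.sq_sqrt (hdpos x (ball_subset_closedBall hx)).le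
    have h1 : ‖x + s x • v x‖ ^ 2 = 2 ^ 2 := by
      rw [norm_add_sq_real, inner_smul_right, norm_smul, mul_pow, Real.norm_eq_abs, sq_abs]
      change ‖x‖ ^ 2 + 2 * (s x * b x) + s x ^ 2 * a x = 2 ^ 2
      have h2 : s x * a x = Real.sqrt (d x) - b x := div_mul_cancel₀ _ (hapos x).ne'
      have h3 : a x * (2 * (s x * b x) + s x ^ 2 * a x + c x) = 0 := by
        have : (s x * a x) ^ 2 + 2 * (s x * a x) * b x + a x * c x = 0 := by
          rw [h2]; simp only [hd] at hsq ⊢; nlinarith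
        linarith
      have h4 := (mul_eq_zero.1 h3).resolve_left (hapos x).ne'
      simp only [hc] at h4
      linarith
    exact (pow_left_inj₀ (norm_nonneg _) two_pos.le two_ne_zero).1 h1

end Brouwer

/-! ### The KKM lemma and Fan's intersection principle. -/

/-- The standard simplex is a continuous retract of the ambient space. -/
lemma exists_continuous_retraction_stdSimplex {ι : Type*} [Fintype ι] [Nonempty ι] :
    ∃ r : (ι → ℝ) → ι → ℝ, Continuous r ∧ (∀ x, r x ∈ stdSimplex ℝ ι) ∧
      ∀ x ∈ stdSimplex ℝ ι, r x = x := by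
  classical
  obtain ⟨j⟩ := ‹Nonempty ι›
  have hpos : ∀ x : ι → ℝ, 0 < max (∑ k, max (x k) 0) 1 := fun x =>
    lt_max_of_lt_right one_pos
  -- Take positive parts, put any missing mass on coordinate `j`, and divide out any excess.
  refine ⟨fun x i => (max (x i) 0 + max (1 - ∑ k, max (x k) 0) 0 * (Pi.single j 1 : ι → ℝ) i) /
    max (∑ k, max (x k) 0) 1, ?_, fun x => ⟨fun i => ?_, ?_⟩, fun x hx => ?_⟩
  · exact continuous_pi fun i => Continuous.div (by fun_prop) (by fun_prop) fun x => (hpos x).ne'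
  · have h1 : (0 : ℝ) ≤ (Pi.single j 1 : ι → ℝ) i := by
      by_cases h : i = j
      · subst h; simp
      · simp [h]
    exact div_nonneg (add_nonneg (le_max_right _ _) (mul_nonneg (le_max_right _ _) h1)) (hpos x).le
  · rw [← Finset.sum_div, Finset.sum_add_distrib, ← Finset.mul_sum, Finset.sum_pi_single',
      if_pos (Finset.mem_univ _), mul_one, div_eq_one_iff_eq (hpos x).ne']
    rcases le_total (∑ k, max (x k) 0) 1 with h | h
    · rw [max_eq_left (sub_nonneg.2 h), max_eq_right h]; ring
    · rw [max_eq_right (sub_nonpos.2 h), max_eq_left h]; ring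
  · have h1 : ∀ i, max (x i) 0 = x i := fun i => max_eq_left (hx.1 i)
    ext i
    simp [h1, hx.2]

/-- The Knaster–Kuratowski–Mazurkiewicz lemma, for open covers of the simplex. -/
theorem exists_mem_stdSimplex_forall_mem_of_cover {ι : Type*} [Fintype ι] [Nonempty ι]
    {V : ι → Set (ι → ℝ)} (hV : ∀ i, IsOpen (V i)) (hcover : stdSimplex ℝ ι ⊆ ⋃ i, V i) :
    ∃ l ∈ stdSimplex ℝ ι, ∀ i, 0 < l i → l ∈ V i := by
  classical
  obtain ⟨r, hrc, hrS, hr⟩ := exists_continuous_retraction_stdSimplex (ι := ι)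
  -- `t x` is the face spanned by the indices whose sets contain `r x`. A partition of unity gives a
  -- `C¹` selection `g`; at a fixed point, which lies in the simplex, `r x = x` and the claim
  -- follows.
  let t : EuclideanSpace ℝ ι → Set (EuclideanSpace ℝ ι) := fun x =>
    {z | z.ofLp ∈ stdSimplex ℝ ι ∧ ∀ i, z i ≠ 0 → r x.ofLp ∈ V i}
  have ht : ∀ x, Convex ℝ (t x) := by
    intro x z hz w hw a b ha hb hab
    refine ⟨convex_stdSimplex ℝ ι hz.1 hw.1 ha hb hab, fun i hi => ?_⟩
    by_cases hzi : z i = 0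
    · refine hw.2 i fun hwi => hi ?_
      simp [hzi, hwi]
    · exact hz.2 i hzi
  have hloc : ∀ x, ∃ c, ∀ᶠ y in 𝓝 x, c ∈ t y := by
    intro x
    obtain ⟨i, hi⟩ := mem_iUnion.1 (hcover (hrS x.ofLp))
    refine ⟨EuclideanSpace.single i 1, ?_⟩
    have hc : Continuous fun y : EuclideanSpace ℝ ι => r y.ofLp :=
      hrc.comp (PiLp.continuous_ofLp 2 _)
    filter_upwards [hc.continuousAt.preimage_mem_nhds ((hV i).mem_nhds hi)] with y hy
    refine ⟨by simpa using single_mem_stdSimplex ℝ i, fun k hk => ?_⟩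
    obtain rfl : k = i := by
      by_contra hne
      exact hk (by simp [hne])
    exact hy
  obtain ⟨g, hg⟩ := exists_contMDiffMap_forall_mem_convex_of_local_const
    (modelWithCornersSelf ℝ (EuclideanSpace ℝ ι)) (n := 1) ht hloc
  have hb : ∀ x, ‖g x‖ ≤ 1 := by
    intro x
    have h1 : ‖g x‖ ^ 2 ≤ 1 := by
      rw [EuclideanSpace.real_norm_sq_eq, ← (hg x).1.2]
      refine Finset.sum_le_sum fun i _ => ?_
      have h0 := (hg x).1.1 i
      have h1 : (g x).ofLp i ≤ 1 := by
        rw [← (hg x).1.2]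
        exact Finset.single_le_sum (fun k _ => (hg x).1.1 k) (Finset.mem_univ i)
      nlinarith
    nlinarith [norm_nonneg (g x)]
  obtain ⟨x, hx⟩ := exists_fixedPoint_of_contDiff_of_norm_le_one g.contMDiff.contDiff hb
  have hxt := hg x
  rw [hx] at hxt
  refine ⟨x.ofLp, hxt.1, fun i hi => ?_⟩
  have := hxt.2 i hi.ne'
  rwa [hr _ hxt.1] at this

/-- Fan's intersection principle: if `U y`, `y ∈ T`, are open and no point of the convex hull of
finitely many points of `T` lies in all the corresponding sets, then these sets do not cover the
compact convex set `S ⊇ T`. -/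
theorem IsCompact.exists_forall_notMem_of_convexCombination {F : Type*} [AddCommGroup F]
    [Module ℝ F] [TopologicalSpace F] [ContinuousAdd F] [ContinuousSMul ℝ F] {S T : Set F}
    (hS : IsCompact S) (hSconv : Convex ℝ S) (hSne : S.Nonempty) (hTS : T ⊆ S) {U : F → Set F}
    (hU : ∀ y ∈ T, IsOpen (U y))
    (h : ∀ (n : ℕ) (y : Fin n → F) (l : Fin n → ℝ), (∀ i, y i ∈ T) → (∀ i, 0 ≤ l i) →
      ∑ i, l i = 1 → ∃ i, 0 < l i ∧ ∑ i, l i • y i ∉ U (y i)) :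
    ∃ x ∈ S, ∀ y ∈ T, x ∉ U y := by
  by_contra! hcon
  obtain ⟨s, hs⟩ := hS.elim_finite_subcover (fun y : T => U y) (fun y => hU y y.2)
    (fun x hx => by
      obtain ⟨y, hy, hxy⟩ := hcon x hx
      exact mem_iUnion.2 ⟨⟨y, hy⟩, hxy⟩)
  let y : Fin s.card → F := fun i => ((s.equivFin.symm i : T) : F)
  have hyT : ∀ i, y i ∈ T := fun i => (s.equivFin.symm i : T).2
  have hcov : ∀ x ∈ S, ∃ i, x ∈ U (y i) := by
    intro x hx
    obtain ⟨z, hz, hxz⟩ := mem_iUnion₂.1 (hs hx)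
    exact ⟨s.equivFin ⟨z, hz⟩, by simpa [y] using hxz⟩
  have : Nonempty (Fin s.card) := by
    obtain ⟨x, hx⟩ := hSne
    exact ⟨(hcov x hx).choose⟩
  have hpc : Continuous fun l : Fin s.card → ℝ => ∑ i, l i • y i :=
    continuous_finsetSum _ fun i _ => (continuous_apply i).smul continuous_const
  obtain ⟨l, hl, hlV⟩ := exists_mem_stdSimplex_forall_mem_of_cover
    (V := fun i => (fun l : Fin s.card → ℝ => ∑ i, l i • y i) ⁻¹' U (y i))
    (fun i => (hU _ (hyT i)).preimage hpc)
    (fun l hl => mem_iUnion.2 (hcov _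
      (hSconv.sum_mem (fun i _ => hl.1 i) hl.2 fun i _ => hTS (hyT i))))
  obtain ⟨i, hi, hiU⟩ := h _ y l hyT hl.1 hl.2
  exact hiU (hlV i hi)

/-! ### Weak compactness and norm density. -/

section Weak

variable {X : Type*} [NormedAddCommGroup X] [NormedSpace ℝ X]

/-- Closed balls of a reflexive space are weakly compact. -/
lemma IsReflexiveSpace.isCompact_toWeakSpace_closedBall (hX : IsReflexiveSpace X) (R : ℝ) :
    IsCompact (toWeakSpace ℝ X '' Metric.closedBall 0 R) := by
  choose j hj using hX
  have hjx : ∀ x, j (NormedSpace.inclusionInDoubleDual ℝ X x) = x := fun x =>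
    (NormedSpace.inclusionInDoubleDualLi ℝ (E := X)).injective (hj _)
  let Φ : WeakDual ℝ (StrongDual ℝ X) → WeakSpace ℝ X := fun ξ =>
    toWeakSpace ℝ X (j (WeakDual.toStrongDual ξ))
  -- Through reflexivity, weak-* evaluation on the bidual is weak evaluation on `X`, so
  -- Banach–Alaoglu transfers.
  have hΦ : Continuous Φ := by
    refine WeakBilin.continuous_of_continuous_eval _ fun φ => ?_
    refine (WeakDual.eval_continuous φ).congr fun ξ => ?_
    have := DFunLike.congr_fun (hj (WeakDual.toStrongDual ξ)) φ
    exact this.symm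
  have hc := (WeakDual.isCompact_closedBall (0 : StrongDual ℝ (StrongDual ℝ X)) R).image hΦ
  convert hc using 1
  ext w
  constructor
  · rintro ⟨x, hx, rfl⟩
    refine ⟨StrongDual.toWeakDual (NormedSpace.inclusionInDoubleDual ℝ X x), ?_, ?_⟩
    · have h1 : ‖NormedSpace.inclusionInDoubleDual ℝ X x‖ = ‖x‖ :=
        (NormedSpace.inclusionInDoubleDualLi ℝ (E := X)).norm_map x
      simpa [h1] using hx
    · exact congrArg (toWeakSpace ℝ X) (hjx x)
  · rintro ⟨ξ, hξ, rfl⟩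
    refine ⟨_, ?_, rfl⟩
    have h1 := (NormedSpace.inclusionInDoubleDualLi ℝ (E := X)).norm_map
      (j (WeakDual.toStrongDual ξ))
    have h2 : NormedSpace.inclusionInDoubleDualLi ℝ (j (WeakDual.toStrongDual ξ)) =
      WeakDual.toStrongDual ξ := hj _
    rw [h2] at h1
    simpa [← h1] using hξ

lemma IsReflexiveSpace.isCompact_toWeakSpace_image (hX : IsReflexiveSpace X) {S : Set X}
    (hconv : Convex ℝ S) (hclosed : IsClosed S) (hb : Bornology.IsBounded S) :
    IsCompact (toWeakSpace ℝ X '' S) := by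
  obtain ⟨R, hR⟩ := hb.subset_closedBall 0
  refine (hX.isCompact_toWeakSpace_closedBall R).of_isClosed_subset ?_ (image_mono hR)
  rw [← closure_eq_iff_isClosed, ← hconv.toWeakSpace_closure ℝ, hclosed.closure_eq]

/-- Inside a norm-compact set, weak closure points are norm closure points. -/
lemma mem_closure_of_toWeakSpace_mem_closure {A S : Set X} (hS : IsCompact S) (hAS : A ⊆ S)
    {x : X} (hx : toWeakSpace ℝ X x ∈ closure (toWeakSpace ℝ X '' A)) : x ∈ closure A := by
  have hc : IsCompact (toWeakSpace ℝ X '' closure A) :=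
    (hS.of_isClosed_subset isClosed_closure (closure_minimal hAS hS.isClosed)).image
      (toWeakSpaceCLM ℝ X).continuous
  obtain ⟨z, hz, hzx⟩ := closure_minimal (image_mono subset_closure) hc.isClosed hx
  rwa [← (toWeakSpace ℝ X).injective hzx]

/-- Segments are norm compact, so weak density in them is norm density. Convexity lets Mazur's
theorem turn weak density of `D` into norm density. -/
lemma IsWeaklySelfSegmentDense.convex_closure {D K : Set X} (hD : IsWeaklySelfSegmentDense D K) :
    Convex ℝ (closure D) := by
  have hseg : ∀ x ∈ D, ∀ y ∈ D, segment ℝ x y ⊆ closure D := by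
    intro x hx y hy z hz
    have himg : segment ℝ (toWeakSpace ℝ X x) (toWeakSpace ℝ X y) =
        toWeakSpace ℝ X '' segment ℝ x y :=
      (image_segment ℝ (toWeakSpace ℝ X).toLinearMap.toAffineMap x y).symm
    have h1 := hD.segment_dense _ (mem_image_of_mem _ hx) _ (mem_image_of_mem _ hy)
    rw [himg, ← image_inter (toWeakSpace ℝ X).injective] at h1
    have hcomp : IsCompact (segment ℝ x y) := by
      rw [segment_eq_image_lineMap]
      exact isCompact_Icc.image (by fun_prop)
    exact closure_mono inter_subset_right (mem_closure_of_toWeakSpace_mem_closure hcomp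
      inter_subset_left (h1 (mem_image_of_mem _ hz)))
  intro x hx y hy a b ha hb hab
  rw [← closure_closure]
  exact map_mem_closure₂ (f := fun x y : X => a • x + b • y) (by fun_prop) hx hy
    fun x hx y hy => hseg x hx y hy ⟨a, b, ha, hb, hab, rfl⟩

/-- A weakly self-segment-dense subset is dense for the norm. -/
lemma IsWeaklySelfSegmentDense.subset_closure {D K : Set X}
    (hD : IsWeaklySelfSegmentDense D K) : K ⊆ closure D := by
  intro x hx
  have h1 := closure_mono (image_mono _root_.subset_closure) (hD.dense (mem_image_of_mem _ hx))
  rw [← hD.convex_closure.toWeakSpace_closure ℝ, closure_closure] at h1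
  obtain ⟨z, hz, hzx⟩ := h1
  rwa [← (toWeakSpace ℝ X).injective hzx]

end Weak

/-! ### Order properties of the cone and of `C`-convex maps. -/

section Cone

variable {Z : Type*} [AddCommGroup Z] [Module ℝ Z] {C : Set Z}

lemma IsConvexPointedCone.zero_mem (hC : IsConvexPointedCone C) : (0 : Z) ∈ C :=
  (hC.inter_neg_eq ▸ mem_singleton (0 : Z) : (0 : Z) ∈ C ∩ -C).1

lemma IsConvexPointedCone.add_mem (hC : IsConvexPointedCone C) {a b : Z} (ha : a ∈ C)
    (hb : b ∈ C) : a + b ∈ C :=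
  hC.add_eq ▸ Set.add_mem_add ha hb

lemma IsConvexPointedCone.sum_mem (hC : IsConvexPointedCone C) {ι : Type*} {s : Finset ι}
    {c : ι → Z} (hc : ∀ i ∈ s, c i ∈ C) : ∑ i ∈ s, c i ∈ C :=
  Finset.sum_induction c (· ∈ C) (fun _ _ => hC.add_mem) hC.zero_mem hc

lemma IsConvexPointedCone.eq_zero (hC : IsConvexPointedCone C) {c : Z} (h : c ∈ C)
    (h' : -c ∈ C) : c = 0 := by
  have : c ∈ C ∩ -C := ⟨h, h'⟩
  rwa [hC.inter_neg_eq] at this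

lemma IsConvexPointedCone.eq_zero_of_sum_eq_zero (hC : IsConvexPointedCone C) {ι : Type*}
    {s : Finset ι} {c : ι → Z} (hc : ∀ i ∈ s, c i ∈ C) (h : ∑ i ∈ s, c i = 0) :
    ∀ i ∈ s, c i = 0 := by
  classical
  intro i hi
  rw [← Finset.add_sum_erase s c hi] at h
  refine hC.eq_zero (hc i hi) ?_
  rw [neg_eq_of_add_eq_zero_right h]
  exact hC.sum_mem fun k hk => hc k (Finset.mem_of_mem_erase hk)

/-- A `C`-convex map is strictly negative at a convex combination of points where it is
nonpositive, as soon as it is nonzero at one of the points with positive weight. -/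
lemma CConvexOn.mem_neg_sdiff {E : Type*} [AddCommGroup E] [Module ℝ E]
    (hC : IsConvexPointedCone C) {K : Set E} {g : E → Z} (hg : CConvexOn C K g) {n : ℕ}
    {x : Fin n → E} {l : Fin n → ℝ} (hx : ∀ i, x i ∈ K) (hl : ∀ i, 0 ≤ l i)
    (hl1 : ∑ i, l i = 1) (hxK : ∑ i, l i • x i ∈ K) (hneg : ∀ i, 0 < l i → g (x i) ∈ -C)
    {j : Fin n} (hj : 0 < l j) (hjne : g (x j) ≠ 0) :
    g (∑ i, l i • x i) ∈ (-C) \ {0} := by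
  have hmem : ∀ i ∈ Finset.univ, l i • -g (x i) ∈ C := by
    intro i _
    rcases (hl i).eq_or_lt with h | h
    · rw [← h, zero_smul]; exact hC.zero_mem
    · exact hC.smul_mem _ (hneg i h) _ h.le
  have hconv := hg n x l hx hl hl1 hxK
  have hsum := hC.sum_mem hmem
  have hsum_neg : ∑ i, l i • -g (x i) = -∑ i, l i • g (x i) := by simp
  rw [hsum_neg] at hsum
  refine ⟨?_, fun h0 => hjne ?_⟩
  · have := hC.add_mem hconv hsum
    rw [sub_add_eq_add_sub, add_neg_cancel, zero_sub] at this
    exact this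
  · rw [mem_singleton_iff.1 h0, sub_zero] at hconv
    have h1 := hC.eq_zero hconv hsum
    have h2 := hC.eq_zero_of_sum_eq_zero hmem (by rw [hsum_neg, h1, neg_zero]) j
      (Finset.mem_univ _)
    exact neg_eq_zero.1 ((smul_eq_zero.1 h2).resolve_left hj.ne')

end Cone

lemma StronglyCUpperSemicontinuousAt.eventually_mem_neg_sdiff {E Z : Type*} [TopologicalSpace E]
    [AddCommGroup Z] {C : Set Z} {K : Set E} {g : E → Z} {x : E} (hg : StronglyCUpperSemicontinuousAt C K g x)
    (hx : g x ∈ (-C) \ {0}) : ∀ᶠ u in 𝓝 x, u ∈ K → g u ∈ (-C) \ {0} := by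
  -- With `k = -g x` the upper bound `g x + k` is `0`.
  obtain ⟨U, hU, h⟩ := hg (-g x) ⟨hx.1, fun h0 => hx.2 (neg_eq_zero.1 h0)⟩
  filter_upwards [hU] with u hu huK
  have hmem := h u ⟨hu, huK⟩
  rw [add_neg_cancel] at hmem
  obtain ⟨z, hz, c, hc, hzc⟩ := hmem
  rw [mem_singleton_iff.1 hz] at hzc
  have hgc : g u = -c := by rw [← hzc]; exact zero_sub c
  rw [hgc]
  exact ⟨by simpa using hc.1, fun h0 => hc.2 (neg_eq_zero.1 h0)⟩

/-! ### The equilibrium theorem. -/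

theorem theoremt22 {X Z : Type*}
    [NormedAddCommGroup X] [NormedSpace ℝ X] [CompleteSpace X] (hX : IsReflexiveSpace X)
    [AddCommGroup Z] [Module ℝ Z] [TopologicalSpace Z] [IsTopologicalAddGroup Z]
    [ContinuousSMul ℝ Z] [T2Space Z] [LocallyConvexSpace ℝ Z]
    (C : Set Z) (hC : IsConvexPointedCone C)
    (K : Set X) (hK_nonempty : K.Nonempty) (hK_convex : Convex ℝ K) (hK_closed : IsClosed K)
    (D : Set X) (hD : IsWeaklySelfSegmentDense D K)
    (f : X → X → Z)
    (h_usc_left : ∀ y ∈ D, ∀ x ∈ K,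
      WeaklyStronglyCUpperSemicontinuousAt C K (fun x' => f x' y) x)
    (h_usc_right : ∀ x ∈ K, ∀ y ∈ K \ D,
      WeaklyStronglyCUpperSemicontinuousAt C K (fun y' => f x y') y)
    (h_convex : ∀ x ∈ K, CConvexOn C K (fun y => f x y))
    (h_diag : ∀ x ∈ K, f x x = 0)
    (h_coercive : ∃ r : ℝ, 0 < r ∧
      ∀ x ∈ K, r < ‖x‖ → ∃ y₀ ∈ K, ‖y₀‖ < ‖x‖ ∧ f x y₀ ∈ -C) :
    ∃ x₀ ∈ K, ∀ y ∈ K, f x₀ y ∉ (-C) \ {0} := by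
  obtain ⟨r, hr, hcoer⟩ := h_coercive
  obtain ⟨a, ha⟩ := hK_nonempty
  let R : ℝ := max r ‖a‖ + 1
  have hrR : r < R := (le_max_left _ _).trans_lt (lt_add_one _)
  have haR : ‖a‖ < R := (le_max_right _ _).trans_lt (lt_add_one _)
  have hDK : D ⊆ K := (image_subset_image_iff (toWeakSpace ℝ X).injective).1 hD.subset
  let e := toWeakSpace ℝ X
  let S : Set X := K ∩ Metric.closedBall 0 R
  have hSconv : Convex ℝ S := hK_convex.inter (convex_closedBall _ _)
  have hS : IsCompact (e '' S) := hX.isCompact_toWeakSpace_image hSconv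
    (hK_closed.inter Metric.isClosed_closedBall) (Metric.isBounded_closedBall.subset
      inter_subset_right)
  -- The ball is open so that norm approximation by points of `D` stays inside it.
  let T : Set X := D ∩ Metric.ball 0 R
  have hTS : T ⊆ S := inter_subset_inter hDK Metric.ball_subset_closedBall
  -- Points outside `K` are admitted, so that relative neighbourhoods in `K` become neighbourhoods
  -- in the whole space.
  let U : WeakSpace ℝ X → Set (WeakSpace ℝ X) := fun y =>
    interior {w | w ∈ e '' K → f (e.symm w) (e.symm y) ∈ (-C) \ {0}}
  obtain ⟨_, ⟨x₀, hx₀, rfl⟩, hx₀U⟩ := hS.exists_forall_notMem_of_convexCombination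
    (hSconv.linear_image e.toLinearMap)
    (Nonempty.image e ⟨a, ha, by simpa using haR.le⟩) (image_mono hTS) (U := U)
    (fun _ _ => isOpen_interior) (by
      intro n y l hy hl hl1
      choose z hzT hz using hy
      by_contra! hcon
      let x : X := ∑ i, l i • z i
      have hxS : x ∈ S := hSconv.sum_mem (fun i _ => hl i) hl1 fun i _ => hTS (hzT i)
      have hex : ∑ i, l i • y i = e x := by
        rw [map_sum]
        exact Finset.sum_congr rfl fun i _ => by rw [map_smul]; exact congrArg _ (hz i).symm
      have hneg : ∀ i, 0 < l i → f x (z i) ∈ (-C) \ {0} := by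
        intro i hi
        have h1 := interior_subset (hcon i hi)
        rw [hex, ← hz i] at h1
        have h2 := h1 (mem_image_of_mem e hxS.1)
        rw [e.symm_apply_apply] at h2
        exact h2
      obtain ⟨j, -, hj⟩ : ∃ j ∈ Finset.univ, 0 < l j := by
        by_contra! hle
        have := Finset.sum_nonpos hle
        linarith
      have := (h_convex x hxS.1).mem_neg_sdiff hC (fun i => hDK (hzT i).1) hl hl1 hxS.1
        (fun i hi => (hneg i hi).1) hj (hneg j hj).2
      exact this.2 (h_diag x hxS.1))
  refine ⟨x₀, hx₀.1, fun y hyK hy => ?_⟩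
  have hD_pos : ∀ d ∈ T, f x₀ d ∉ (-C) \ {0} := by
    intro d hd hneg
    refine hx₀U (e d) (mem_image_of_mem e hd) (mem_interior_iff_mem_nhds.2 ?_)
    have h1 := (h_usc_left d hd.1 x₀ hx₀.1).eventually_mem_neg_sdiff
      (by simpa using hneg)
    filter_upwards [h1] with w hw hwK
    simpa [e] using hw hwK
  -- If `‖x₀‖ < R`, `x₀` itself serves; coercivity is needed only on the sphere.
  obtain ⟨b, hbK, hbR, hb⟩ : ∃ b ∈ K, ‖b‖ < R ∧ f x₀ b ∈ -C := by
    have hle : ‖x₀‖ ≤ R := by simpa using hx₀.2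
    rcases hle.lt_or_eq with hlt | heq
    · refine ⟨x₀, hx₀.1, hlt, ?_⟩
      rw [h_diag x₀ hx₀.1, Set.mem_neg, neg_zero]
      exact hC.zero_mem
    · obtain ⟨b, hbK, hb, hfb⟩ := hcoer x₀ hx₀.1 (heq ▸ hrR)
      exact ⟨b, hbK, heq ▸ hb, hfb⟩
  obtain ⟨p, hpK, hpR, hp⟩ : ∃ p ∈ K, ‖p‖ < R ∧ f x₀ p ∈ (-C) \ {0} := by
    have hlim : ∀ᶠ t : ℝ in 𝓝 0, ‖(1 - t) • b + t • y‖ < R :=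
      ContinuousAt.eventually_lt (by fun_prop) continuousAt_const (by simpa using hbR)
    obtain ⟨t, ⟨htR, ht1⟩, ht0⟩ :=
      (((hlim.and (gt_mem_nhds one_pos)).filter_mono nhdsWithin_le_nhds).and
        (self_mem_nhdsWithin (s := Ioi (0 : ℝ)))).exists
    have ht0' : 0 < t := ht0
    have hpK : (1 - t) • b + t • y ∈ K :=
      hK_convex hbK hyK (sub_nonneg.2 ht1.le) ht0'.le (sub_add_cancel _ _)
    -- Only `y` is known to give a nonzero value, so its weight `t` must be positive.
    have key := (h_convex x₀ hx₀.1).mem_neg_sdiff hC (x := ![b, y]) (l := ![1 - t, t]) (j := 1)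
      (by simp [Fin.forall_fin_two, hbK, hyK])
      (by simp [Fin.forall_fin_two, ht0'.le, ht1.le])
      (by simp) (by simpa using hpK)
      (by
        intro i _
        fin_cases i
        · exact hb
        · exact hy.1)
      ht0' hy.2
    exact ⟨_, hpK, htR, by simpa using key⟩
  obtain ⟨d, hd, hdneg⟩ : ∃ d ∈ T, f x₀ d ∈ (-C) \ {0} := by
    by_cases hpD : p ∈ D
    · exact ⟨p, ⟨hpD, by simpa using hpR⟩, hp⟩
    · have h1 := (h_usc_right x₀ hx₀.1 p ⟨hpK, hpD⟩).eventually_mem_neg_sdiff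
        (by simpa using hp)
      have h2 := (toWeakSpaceCLM ℝ X).continuous.continuousAt.eventually h1
      have h3 : ∀ᶠ q in 𝓝 p, q ∈ Metric.ball (0 : X) R :=
        Metric.isOpen_ball.mem_nhds (by simpa using hpR)
      obtain ⟨d, ⟨hd2, hd3⟩, hdD⟩ := mem_closure_iff_nhds.1 (hD.subset_closure hpK) _ (h2.and h3)
      exact ⟨d, ⟨hdD, hd3⟩, by simpa using hd2 (mem_image_of_mem _ (hDK hdD))⟩
  exact hD_pos d hd hdneg
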